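/- Let $n\ge 1$ and $\Delta_n=\{x\in\mathbb R_{\ge 0}^n:\sum_i x^i=1\}$. Let $P$ be a finitely supported probability distribution on $[0,1]^n$, with distinct values $\beta_1,\dots,\beta_L$ taken with probabilities $p_1,\dots,p_L$. For a horizon $T$, resources with utility vectors $b_1,\dots,b_T$ drawn independently from $P$ arrive one by one; resource $t$ is divided among $n$ agents according to some $x_t\in\Delta_n$, chosen knowing only $b_1,\dots,b_t$, and $B_t^i=\sum_{s\le t}b_s^i x_s^i$ is the utility of agent $i$ after period $t$. The welfare is $\min_i B_T^i$, the hindsight optimum is $\mathsf{OPT}=\max\{\min_i\sum_{t=1}^T b_t^i y_t^i : y_1,\dots,y_T\in\Delta_n\}$, and the regret of a policy is $\mathcal R_T=\mathbb E[\mathsf{OPT}-\min_i B_T^i]$. For $\eta\in(1,4/3)$, the policy $\mathsf{BIRT}_\eta$ is defined as follows. Let $K=\lceil \log\log T/\log\eta\rceil$ (and $K=0$ if $T\le 2$), $t_0=0$, $t_k=T-\lfloor\exp(\eta^{K-k})\rfloor$ for $1\le k\le K$, $t_{K+1}=T$, $\gamma_k=\dfrac{T-t_{k+1}}{2n^2(T-t_k)}$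 for $0\le k<K$, and $\gamma_K=0$. At each epoch $k=0,1,\dots,K$, at time $t_k$, choose a maximizer $\xi=(\xi_\ell)_{\ell\le L}\in\Delta_n^L$ of the updated fluid problem $$\max_{\xi\in\Delta_n^L}\ \min_i\Big(B_{t_k}^i+(T-t_k)\sum_{\ell=1}^L p_\ell\,\beta_\ell^i\,\xi_\ell^i\Big);$$ for each $\ell$ choose $j_\ell\in\arg\max_i\xi_\ell^i$, and set $\tilde\xi_\ell^i=\xi_\ell^i\mathbf 1\{\xi_\ell^i\ge\gamma_k\}$ for $i\ne j_\ell$ and $\tilde\xi_\ell^{j_\ell}=1-\sum_{i\ne j_\ell}\tilde\xi_\ell^i$. In the periods $t_k<t\le t_{k+1}$, allocate $x_t=\tilde\xi_\ell$ whenever $b_t=\beta_\ell$. The choices of $\xi$ and $j_\ell$ (ties) may be made in any way that depends only on $b_1,\dots,b_{t_k}$. Theorem. For every such $P$ and every $\eta\in(1,4/3)$ there is a constant $C$, determined by $P$ and $\eta$ only, such that $|\mathcal R_T(\mathsf{BIRT}_\eta)|\le C$ for every horizon $T$ and every choice of maximizers in $\mathsf{BIRT}_\eta$; that is, $\mathcal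 R_T(\mathsf{BIRT}_\eta)=O(1)$. -/

import Mathlib

open MeasureTheory

noncomputable section

/-- A finite probability distribution of the agents' marginal utility vectors with values in
`[0,1]^n`: there are `L` distinct arrival types, type `ℓ` has utility vector `β ℓ` and
probability `p ℓ`. -/
structure AdmissibleDist (n : ℕ) where
  L : ℕ
  β : Fin L → Fin n → ℝ
  β_mem : ∀ ℓ i, β ℓ i ∈ Set.Icc (0 : ℝ) 1
  β_injective : Function.Injective β
  p : Fin L → ℝ
  p_mem : p ∈ stdSimplex ℝ (Fin L)

/-- The egalitarian welfare `min_i B^i`. -/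
def egalWelfare {n : ℕ} (B : Fin n → ℝ) : ℝ := ⨅ i, B i

namespace AdmissibleDist

variable {n : ℕ} (P : AdmissibleDist n)

/-- The law of the type of a single arrival. -/
def typeLaw : Measure (Fin P.L) := ∑ ℓ, ENNReal.ofReal (P.p ℓ) • Measure.dirac ℓ

instance instIsProbabilityMeasureTypeLaw : IsProbabilityMeasure P.typeLaw := by
  constructor
  have h := P.p_mem
  simp only [typeLaw, Measure.coe_finsetSum, Finset.sum_apply, Measure.smul_apply,
    measure_univ, smul_eq_mul, mul_one]
  rw [← ENNReal.ofReal_sum_of_nonneg fun ℓ _ => h.1 ℓ, h.2, ENNReal.ofReal_one]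

/-- A realization of the `T` arrivals: period `s + 1` brings a resource of type `ω s`, that is,
with utility vector `b_{s+1} = β (ω s)`. -/
abbrev Path (T : ℕ) : Type := Fin T → Fin P.L

/-- The law of `T` independent and identically distributed arrivals. -/
def pathLaw (T : ℕ) : Measure (P.Path T) := Measure.pi fun _ => P.typeLaw

/-- The agents' utilities `B_t` after the first `t` periods, if the arrivals are `ω` and the
resource of period `s + 1` is shared according to `y s`. -/
def utility {T : ℕ} (ω : P.Path T) (y : Fin T → Fin n → ℝ) (t : ℕ) : Fin n → ℝ :=
  fun i => ∑ s ∈ Finset.univ.filter (fun s : Fin T => (s : ℕ) < t), P.β (ω s) i * y s i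

/-- The hindsight optimum: the largest egalitarian welfare of an allocation sequence in
`Δ_n^T` chosen with full knowledge of the arrivals `ω`. -/
def hindsightOpt {T : ℕ} (ω : P.Path T) : ℝ :=
  sSup ((fun y : Fin T → Fin n → ℝ => egalWelfare (P.utility ω y T)) ''
    {y | ∀ s, y s ∈ stdSimplex ℝ (Fin n)})

/-- An allocation policy: `x ω s` is the allocation of the resource of period `s + 1` when the
arrivals are `ω`. -/
abbrev Policy (T : ℕ) : Type := P.Path T → Fin T → Fin n → ℝ

/-- The regret under the egalitarian welfare: the expected loss against the hindsight optimum. -/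
def regret {T : ℕ} (x : P.Policy T) : ℝ :=
  ∫ ω, (P.hindsightOpt ω - egalWelfare (P.utility ω (x ω) T)) ∂(P.pathLaw T)

/-- The expected terminal utilities from current utilities `B` when `τ` periods remain and the
static policy `ξ` is used in all of them. -/
def forecast (B : Fin n → ℝ) (τ : ℝ) (ξ : Fin P.L → Fin n → ℝ) : Fin n → ℝ :=
  fun i => B i + τ * ∑ ℓ, P.p ℓ * P.β ℓ i * ξ ℓ i

/-- `ξ` solves the updated fluid problem, with current utilities `B` and `τ` remaining periods. -/
def IsFluidSolution (B : Fin n → ℝ) (τ : ℝ) (ξ : Fin P.L → Fin n → ℝ) : Prop :=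
  (∀ ℓ, ξ ℓ ∈ stdSimplex ℝ (Fin n)) ∧
    ∀ ξ' : Fin P.L → Fin n → ℝ, (∀ ℓ, ξ' ℓ ∈ stdSimplex ℝ (Fin n)) →
      egalWelfare (P.forecast B τ ξ') ≤ egalWelfare (P.forecast B τ ξ)

end AdmissibleDist

/-- The thresholding rule with threshold `γ` for one resource type: every agent other than `j`
loses its share `v i` if it is below `γ`, and agent `j` receives all that remains. -/
def thresholded {n : ℕ} (γ : ℝ) (j : Fin n) (v : Fin n → ℝ) : Fin n → ℝ :=
  fun i =>
    if i = j then 1 - ∑ i' ∈ Finset.univ.erase j, (if γ ≤ v i' then v i' else 0)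
    else if γ ≤ v i then v i else 0

/-- The number of re-solving epochs `K = ⌈log log T / log η⌉` (and `K = 0` if `T ≤ 2`). -/
def numResolves (η : ℝ) (T : ℕ) : ℕ := ⌈Real.log (Real.log T) / Real.log η⌉₊

/-- The re-solving times: `t_0 = 0`, `t_k = T - ⌊exp (η ^ (K - k))⌋` for `1 ≤ k ≤ K`, and
`t_{K+1} = T`. -/
def resolveTime (η : ℝ) (T : ℕ) (k : ℕ) : ℕ :=
  if k = 0 then 0
  else if k ≤ numResolves η T then T - ⌊Real.exp (η ^ (numResolves η T - k))⌋₊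
  else T

/-- The thresholds: `γ_k = (T - t_{k+1}) / (2 n² (T - t_k))` for `k < K`, and `γ_K = 0`. -/
def resolveThreshold (n : ℕ) (η : ℝ) (T : ℕ) (k : ℕ) : ℝ :=
  if k < numResolves η T then
    ((T : ℝ) - resolveTime η T (k + 1)) / (2 * (n : ℝ) ^ 2 * ((T : ℝ) - resolveTime η T k))
  else 0

namespace AdmissibleDist

variable {n : ℕ} (P : AdmissibleDist n)

/-- `x` is a policy `BIRT_η` (Backward Infrequent Re-solving with Thresholding) for `T` periods:
at each epoch `k = 0, …, K`, knowing only the arrivals of the periods `1, …, t_k`, it selects an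
optimal solution `ξ k` of the updated fluid problem and for every type `ℓ` an agent `j k ℓ` with
the largest share in it, and in the periods `t_k + 1, …, t_{k+1}` it follows the static policy
that results from thresholding `ξ k`. Ties may be broken in any way, also depending on the past
arrivals. -/
def IsBIRT (η : ℝ) {T : ℕ} (x : P.Policy T) : Prop :=
  ∃ (ξ : ℕ → P.Path T → Fin P.L → Fin n → ℝ) (j : ℕ → P.Path T → Fin P.L → Fin n),
    ∀ k ≤ numResolves η T,
      (∀ ω ω' : P.Path T, (∀ s : Fin T, (s : ℕ) < resolveTime η T k → ω s = ω' s) →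
        ξ k ω = ξ k ω' ∧ j k ω = j k ω') ∧
      ∀ ω : P.Path T,
        P.IsFluidSolution (P.utility ω (x ω) (resolveTime η T k))
          ((T : ℝ) - resolveTime η T k) (ξ k ω) ∧
        (∀ ℓ i, ξ k ω ℓ i ≤ ξ k ω ℓ (j k ω ℓ)) ∧
        ∀ s : Fin T, resolveTime η T k ≤ (s : ℕ) → (s : ℕ) < resolveTime η T (k + 1) →
          x ω s = thresholded (resolveThreshold n η T k) (j k ω (ω s)) (ξ k ω (ω s))

end AdmissibleDist

end

/-! Call `v` attainable at time `t` if the arrivals that actually come after `t` can be divided so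
that, on top of the current utilities, every agent gets at least `v` (`IsDivision`). The welfare of
every allocation is attainable at time 0, so the loss is controlled by how far this target must be
lowered until the end.

Consider an epoch with `τ` periods left before it and `τ'` after it, and suppose that the arrival
counts deviate from their means by at most `s`. The fluid solution then violates the constraints of
an actual division by `O(s)` only. Hoffman's bound yields a true division within `κ * s` of it, with
`κ` independent of the current utilities (`exists_isDivision_near_fluid`). Subtracting what the
policy hands out leaves a division of the later arrivals, provided that nothing becomes negative
(`IsDivision.sub_thresholded`): a discarded share takes nothing, and a share of at least `γ` leaves
about `p * τ' * γ`, which exceeds the error for `s = c * τ' ^ 2 / τ`. Such an epoch costs nothing.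

Any other epoch costs at most `τ`. By Hoeffding it has probability of order `exp (-const * τ' ^ 4 /
τ ^ 3)`. With `τ ≤ exp (η ^ (m + 1))` and `τ' ≥ exp (η ^ m) / 2`, the exponent grows like `exp ((4 -
3 * η) * η ^ m)`, so for `η < 4 / 3` the expected costs are summable in `m` (`summable_epochBound`).
After the last re-solve at most `e` periods remain. -/

/-! ### Hoffman's error bound by Fourier–Motzkin elimination -/

/-- A real number between finitely many lower and upper bounds can be chosen close to `t₀`. -/
theorem exists_between_near {κ ι : Type*} [Fintype κ] (lo : κ → ℝ) (hi : ι → ℝ) (t₀ R : ℝ)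
    (hR : 0 ≤ R) (h : ∀ k j, lo k ≤ hi j) (hlo : ∀ k, lo k ≤ t₀ + R) (hhi : ∀ j, t₀ - R ≤ hi j) :
    ∃ t, (∀ k, lo k ≤ t) ∧ (∀ j, t ≤ hi j) ∧ |t - t₀| ≤ R := by
  -- The extra lower bound `t₀ - R` makes the index type nonempty and keeps the maximum from falling
  -- too far below `t₀`.
  let f : Option κ → ℝ := fun o => o.elim (t₀ - R) lo
  have hf : ∀ o, f o ≤ Finset.univ.sup' Finset.univ_nonempty f := fun o =>
    Finset.le_sup' f (Finset.mem_univ o)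
  refine ⟨Finset.univ.sup' Finset.univ_nonempty f, fun k => hf (some k), fun j => ?_, ?_⟩
  · refine Finset.sup'_le _ _ fun o _ => ?_
    cases o with
    | none => exact hhi j
    | some k => exact h k j
  · rw [abs_le]
    constructor
    · have := hf none
      change t₀ - R ≤ _ at this
      linarith
    · rw [sub_le_iff_le_add']
      refine Finset.sup'_le _ _ fun o _ => ?_
      cases o with
      | none => change t₀ - R ≤ _; linarith
      | some k => exact hlo k

/-- The property of a type `σ` of variables that all systems `A x ≤ b` satisfy Hoffman's error
bound with a constant that depends on `A` only. -/
def HoffmanBound (σ : Type) [Fintype σ] : Prop :=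
  ∀ (ι : Type) [Fintype ι] (A : ι → σ → ℝ), ∃ κ : ℝ, 0 ≤ κ ∧
    ∀ (b : ι → ℝ) (x₀ : σ → ℝ) (δ : ℝ), 0 ≤ δ → (∃ x : σ → ℝ, ∀ j, ∑ i, A j i * x i ≤ b j) →
      (∀ j, ∑ i, A j i * x₀ i ≤ b j + δ) →
        ∃ x : σ → ℝ, (∀ j, ∑ i, A j i * x i ≤ b j) ∧ ∀ i, |x i - x₀ i| ≤ κ * δ

theorem HoffmanBound.of_equiv {α β : Type} [Fintype β] [Fintype α] (e : α ≃ β)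
    (h : HoffmanBound α) : HoffmanBound β := by
  intro ι _ A
  obtain ⟨κ, hκ, H⟩ := h ι fun j i => A j (e i)
  have key : ∀ (j : ι) (x : β → ℝ), ∑ i, A j (e i) * x (e i) = ∑ i, A j i * x i := fun j x =>
    e.sum_comp fun i => A j i * x i
  refine ⟨κ, hκ, fun b x₀ δ hδ ⟨x, hx⟩ hx₀ => ?_⟩
  obtain ⟨y, hy, hyd⟩ := H b (x₀ ∘ e) δ hδ ⟨x ∘ e, fun j => (key j x).trans_le (hx j)⟩
    fun j => (key j x₀).trans_le (hx₀ j)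
  refine ⟨y ∘ e.symm, fun j => ?_, fun i => by simpa using hyd (e.symm i)⟩
  rw [← key]
  simpa using hy j

theorem HoffmanBound.of_isEmpty : HoffmanBound PEmpty := by
  intro ι _ A
  refine ⟨0, le_rfl, fun b x₀ δ _ ⟨x, hx⟩ _ => ⟨x, hx, fun i => i.elim⟩⟩

/-- Fourier–Motzkin elimination of one variable preserves Hoffman's error bound. -/
theorem HoffmanBound.option {α : Type} [Fintype α] (h : HoffmanBound α) :
    HoffmanBound (Option α) := by
  intro ι _ A
  classical
  let c : ι → ℝ := fun j => A j none
  let a : ι → α → ℝ := fun j i => A j (some i)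
  have hA : ∀ (j : ι) (x : Option α → ℝ),
      ∑ i, A j i * x i = c j * x none + ∑ i, a j i * x (some i) := fun j x =>
    Fintype.sum_option _
  let ι' := {j // c j = 0} ⊕ ({j // 0 < c j} × {j // c j < 0})
  let A' : ι' → α → ℝ := Sum.elim (fun j => a j)
    (fun q i => a q.1 i / c q.1 - a q.2 i / c q.2)
  obtain ⟨κ, hκ, H⟩ := h ι' A'
  have hpair : ∀ (q : {j // 0 < c j} × {j // c j < 0}) (x : α → ℝ),
      ∑ i, A' (.inr q) i * x i
        = (∑ i, a q.1 i * x i) / c q.1 - (∑ i, a q.2 i * x i) / c q.2 := by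
    intro q x
    rw [Finset.sum_div, Finset.sum_div, ← Finset.sum_sub_distrib]
    refine Finset.sum_congr rfl fun i _ => ?_
    change (a q.1 i / c q.1 - a q.2 i / c q.2) * x i = _
    ring
  -- `M` bounds the growth of a residual `δ` under elimination: a pair of rows turns it into `δ *
  -- (|c j|⁻¹ + |c k|⁻¹) ≤ M * δ`, an untouched row keeps it.
  set M : ℝ := 1 + 2 * ∑ j, |c j|⁻¹ with hM
  have hcM : ∀ j, 2 * |c j|⁻¹ ≤ M - 1 := fun j => by
    have := Finset.single_le_sum (f := fun j => |c j|⁻¹) (fun j _ => by positivity)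
      (Finset.mem_univ j)
    linarith
  have hM1 : 1 ≤ M := by
    have : 0 ≤ ∑ j, |c j|⁻¹ := Finset.sum_nonneg fun j _ => by positivity
    linarith
  set S : ℝ := ∑ j, ∑ i, |a j i| with hS
  have hS0 : 0 ≤ S := Finset.sum_nonneg fun j _ => Finset.sum_nonneg fun i _ => abs_nonneg _
  have haS : ∀ j, ∑ i, |a j i| ≤ S := fun j =>
    Finset.single_le_sum (f := fun j => ∑ i, |a j i|)
      (fun j _ => Finset.sum_nonneg fun i _ => abs_nonneg _) (Finset.mem_univ j)
  -- The first summand is for the old variables, the second for the eliminated one: with `y` in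
  -- place of `x₀` the rows hold up to `(1 + S * (κ * M)) * δ`, and dividing by `c j` costs a factor
  -- of at most `M`.
  refine ⟨κ * M + M * (1 + S * (κ * M)), by positivity, ?_⟩
  intro b x₀ δ hδ ⟨x, hx⟩ hx₀
  simp only [hA] at hx hx₀
  have hpos : ∀ (j : ι) (u v r : ℝ), 0 < c j → c j * u + v ≤ r → u ≤ r / c j - v / c j := by
    intro j u v r hj hle
    rw [← sub_div, le_div_iff₀ hj]
    linarith
  have hneg : ∀ (j : ι) (u v r : ℝ), c j < 0 → c j * u + v ≤ r → r / c j - v / c j ≤ u := by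
    intro j u v r hj hle
    rw [← sub_div, div_le_iff_of_neg hj]
    linarith
  let b' : ι' → ℝ := Sum.elim (fun j => b j) fun q => b q.1 / c q.1 - b q.2 / c q.2
  obtain ⟨y, hy, hyd⟩ := H b' (fun i => x₀ (some i)) (M * δ) (by positivity)
    ⟨fun i => x (some i), by
      rintro (j | q)
      · have := hx j
        rw [j.2, zero_mul, zero_add] at this
        exact this
      · rw [hpair]
        have h1 := hpos _ _ _ _ q.1.2 (hx q.1)
        have h2 := hneg _ _ _ _ q.2.2 (hx q.2)
        change _ ≤ b q.1 / c q.1 - b q.2 / c q.2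
        linarith⟩ (by
      rintro (j | q)
      · have := hx₀ j
        rw [j.2, zero_mul, zero_add] at this
        change ∑ i, a j i * _ ≤ b j + _
        nlinarith
      · rw [hpair]
        have h1 := hpos _ _ _ _ q.1.2 (hx₀ q.1)
        have h2 := hneg _ _ _ _ q.2.2 (hx₀ q.2)
        change _ ≤ b q.1 / c q.1 - b q.2 / c q.2 + _
        have e1 := hcM q.1
        have e2 := hcM q.2
        rw [abs_of_pos q.1.2] at e1
        rw [abs_of_neg q.2.2, inv_neg] at e2
        rw [add_div] at h1 h2
        have e3 : δ / c q.1 - δ / c q.2 ≤ M * δ := by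
          rw [div_eq_mul_inv, div_eq_mul_inv]
          nlinarith
        linarith)
  have hclose : ∀ j, ∑ i, a j i * y i ≤ ∑ i, a j i * x₀ (some i) + S * (κ * (M * δ)) := by
    intro j
    have h1 : ∑ i, a j i * y i - ∑ i, a j i * x₀ (some i)
        ≤ ∑ i, |a j i| * (κ * (M * δ)) := by
      rw [← Finset.sum_sub_distrib]
      refine Finset.sum_le_sum fun i _ => ?_
      rw [← mul_sub]
      refine (le_abs_self _).trans ?_
      rw [abs_mul]
      exact mul_le_mul_of_nonneg_left (hyd i) (abs_nonneg _)
    rw [← Finset.sum_mul] at h1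
    have h2 : (∑ i, |a j i|) * (κ * (M * δ)) ≤ S * (κ * (M * δ)) :=
      mul_le_mul_of_nonneg_right (haS j) (by positivity)
    linarith
  have hslack : ∀ j, c j * x₀ none + ∑ i, a j i * y i
      ≤ b j + (1 + S * (κ * M)) * δ := fun j => by
    have h1 := hclose j
    have h2 := hx₀ j
    nlinarith
  have hscale : ∀ j, |c j|⁻¹ * ((1 + S * (κ * M)) * δ) ≤ M * (1 + S * (κ * M)) * δ := fun j => by
    have h1 := hcM j
    have h2 : 0 ≤ |c j|⁻¹ := by positivity
    have h3 : 0 ≤ (1 + S * (κ * M)) * δ := by positivity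
    rw [mul_assoc M]
    exact mul_le_mul_of_nonneg_right (by linarith) h3
  obtain ⟨t, ht1, ht2, ht3⟩ := exists_between_near
    (fun k : {j // c j < 0} => b k / c k - (∑ i, a k i * y i) / c k)
    (fun j : {j // 0 < c j} => b j / c j - (∑ i, a j i * y i) / c j)
    (x₀ none) (M * (1 + S * (κ * M)) * δ) (by positivity)
    (fun k j => by
      have := hy (.inr (j, k))
      rw [hpair] at this
      change _ ≤ b j / c j - b k / c k at this
      dsimp only at this ⊢
      linarith)
    (fun k => by
      have h1 := hneg _ _ _ _ k.2 (hslack k)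
      have h2 := hscale k
      rw [abs_of_neg k.2, inv_neg] at h2
      rw [add_div, div_eq_inv_mul (_ * δ)] at h1
      linarith)
    (fun j => by
      have h1 := hpos _ _ _ _ j.2 (hslack j)
      have h2 := hscale j
      rw [abs_of_pos j.2] at h2
      rw [add_div, div_eq_inv_mul (_ * δ)] at h1
      linarith)
  refine ⟨fun o => o.elim t y, fun j => ?_, ?_⟩
  · rw [hA]
    change c j * t + ∑ i, a j i * y i ≤ b j
    rcases lt_trichotomy (c j) 0 with hj | hj | hj
    · have := ht1 ⟨j, hj⟩
      dsimp only at this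
      rw [← sub_div, div_le_iff_of_neg hj] at this
      linarith
    · have := hy (.inl ⟨j, hj⟩)
      change ∑ i, a j i * y i ≤ b j at this
      rw [hj]
      linarith
    · have := ht2 ⟨j, hj⟩
      dsimp only at this
      rw [← sub_div, le_div_iff₀ hj] at this
      linarith
  · have h1 : 0 ≤ κ * M * δ := by positivity
    have h2 : 0 ≤ M * (1 + S * (κ * M)) * δ := by positivity
    rintro (_ | i)
    · change |t - x₀ none| ≤ _
      linarith
    · have := hyd i
      change |y i - x₀ (some i)| ≤ _
      linarith

/-- **Hoffman's error bound** for systems of linear inequalities. -/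
theorem hoffmanBound (σ : Type) [Fintype σ] : HoffmanBound σ :=
  Fintype.induction_empty_option (P := fun σ _ => HoffmanBound σ)
    (fun _ _ _ e h => @HoffmanBound.of_equiv _ _ _ (Fintype.ofEquiv _ e.symm) e h)
    HoffmanBound.of_isEmpty (fun _ _ h => h.option) σ

/-! ### The thresholding rule -/

section Thresholding

variable {n : ℕ} {γ : ℝ} {j : Fin n} {v : Fin n → ℝ}

theorem sum_thresholded (γ : ℝ) (j : Fin n) (v : Fin n → ℝ) : ∑ i, thresholded γ j v i = 1 := by
  rw [← Finset.add_sum_erase _ _ (Finset.mem_univ j)]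
  have h : ∑ i ∈ Finset.univ.erase j, thresholded γ j v i
      = ∑ i ∈ Finset.univ.erase j, (if γ ≤ v i then v i else 0) :=
    Finset.sum_congr rfl fun i hi => if_neg (Finset.ne_of_mem_erase hi)
  rw [h, thresholded, if_pos rfl]
  ring

theorem le_thresholded_self (hv : v ∈ stdSimplex ℝ (Fin n)) : v j ≤ thresholded γ j v j := by
  rw [thresholded, if_pos rfl]
  have h := hv.2
  rw [← Finset.add_sum_erase _ _ (Finset.mem_univ j)] at h
  have : ∑ i ∈ Finset.univ.erase j, (if γ ≤ v i then v i else 0)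
      ≤ ∑ i ∈ Finset.univ.erase j, v i := Finset.sum_le_sum fun i _ => by
    split_ifs
    · exact le_rfl
    · exact hv.1 i
  linarith

/-- Agent `j` collects at most `n` discarded shares, each below `γ`. -/
theorem thresholded_self_le (hγ : 0 ≤ γ) (hv : v ∈ stdSimplex ℝ (Fin n)) :
    thresholded γ j v j ≤ v j + n * γ := by
  rw [thresholded, if_pos rfl]
  have h := hv.2
  rw [← Finset.add_sum_erase _ _ (Finset.mem_univ j)] at h
  have h1 : ∑ i ∈ Finset.univ.erase j, v i ≤
      ∑ i ∈ Finset.univ.erase j, ((if γ ≤ v i then v i else 0) + γ) :=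
    Finset.sum_le_sum fun i _ => by split_ifs <;> linarith
  have h2 : ∑ _i ∈ Finset.univ.erase j, γ ≤ ∑ _i : Fin n, γ :=
    Finset.sum_le_sum_of_subset_of_nonneg (Finset.erase_subset _ _) fun _ _ _ => hγ
  rw [Finset.sum_add_distrib] at h1
  simp only [Finset.sum_const, Finset.card_univ, Fintype.card_fin, nsmul_eq_mul] at h1 h2
  linarith

theorem thresholded_mem_stdSimplex (hv : v ∈ stdSimplex ℝ (Fin n)) :
    thresholded γ j v ∈ stdSimplex ℝ (Fin n) := by
  refine ⟨fun i => ?_, sum_thresholded γ j v⟩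
  by_cases h : i = j
  · subst h
    exact (hv.1 i).trans (le_thresholded_self hv)
  · rw [thresholded, if_neg h]
    split_ifs
    · exact hv.1 i
    · exact le_rfl

theorem le_one_of_mem_stdSimplex (hv : v ∈ stdSimplex ℝ (Fin n)) (i : Fin n) : v i ≤ 1 :=
  hv.2 ▸ Finset.single_le_sum (fun i _ => hv.1 i) (Finset.mem_univ i)

end Thresholding

theorem le_egalWelfare_iff {n : ℕ} (hn : 0 < n) {B : Fin n → ℝ} {v : ℝ} :
    v ≤ egalWelfare B ↔ ∀ i, v ≤ B i := by
  have : Nonempty (Fin n) := ⟨⟨0, hn⟩⟩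
  exact le_ciInf_iff (Set.finite_range B).bddBelow

/-! ### Time windows, arrival counts and utilities -/

/-- The periods `a + 1, …, b` of the horizon `T`. -/
def periods (T a b : ℕ) : Finset (Fin T) :=
  Finset.univ.filter fun s : Fin T => a ≤ (s : ℕ) ∧ (s : ℕ) < b

theorem mem_periods {T a b : ℕ} {s : Fin T} : s ∈ periods T a b ↔ a ≤ (s : ℕ) ∧ (s : ℕ) < b := by
  simp [periods]

theorem card_periods {T a b : ℕ} (hb : b ≤ T) : (periods T a b).card = b - a := by
  rw [← Nat.card_Ico, ← Finset.card_map Fin.valEmbedding]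
  congr 1
  ext m
  simp only [Finset.mem_map, mem_periods, Finset.mem_Ico, Fin.valEmbedding_apply]
  constructor
  · rintro ⟨s, hs, rfl⟩
    exact hs
  · exact fun hm => ⟨⟨m, hm.2.trans_le hb⟩, hm, rfl⟩

theorem sum_periods_add {T a b c : ℕ} (hab : a ≤ b) (hbc : b ≤ c) (f : Fin T → ℝ) :
    ∑ s ∈ periods T a b, f s + ∑ s ∈ periods T b c, f s = ∑ s ∈ periods T a c, f s := by
  rw [← Finset.sum_union]
  · congr 1
    ext s
    simp only [Finset.mem_union, mem_periods]
    omega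
  · rw [Finset.disjoint_left]
    intro s
    simp only [mem_periods]
    omega

namespace AdmissibleDist

variable {n : ℕ} (P : AdmissibleDist n)

/-- The number of arrivals of each type in the periods `a + 1, …, b`. -/
noncomputable def arrivals {T : ℕ} (ω : P.Path T) (a b : ℕ) (ℓ : Fin P.L) : ℝ :=
  ∑ s ∈ periods T a b, if ω s = ℓ then 1 else 0

variable {P} in
theorem arrivals_nonneg {T : ℕ} (ω : P.Path T) (a b : ℕ) (ℓ : Fin P.L) :
    0 ≤ P.arrivals ω a b ℓ :=
  Finset.sum_nonneg fun s _ => by split_ifs <;> norm_num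

variable {P} in
theorem arrivals_add {T : ℕ} (ω : P.Path T) {a b c : ℕ} (hab : a ≤ b) (hbc : b ≤ c)
    (ℓ : Fin P.L) : P.arrivals ω a b ℓ + P.arrivals ω b c ℓ = P.arrivals ω a c ℓ :=
  sum_periods_add hab hbc _

theorem sum_arrivals_mul {T : ℕ} (ω : P.Path T) (a b : ℕ) (f : Fin P.L → ℝ) :
    ∑ ℓ, P.arrivals ω a b ℓ * f ℓ = ∑ s ∈ periods T a b, f (ω s) := by
  simp only [arrivals, Finset.sum_mul]
  rw [Finset.sum_comm]
  exact Finset.sum_congr rfl fun s _ => by simp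

theorem sum_arrivals {T : ℕ} (ω : P.Path T) {a b : ℕ} (hb : b ≤ T) :
    ∑ ℓ, P.arrivals ω a b ℓ = (b - a : ℕ) := by
  have h := P.sum_arrivals_mul ω a b fun _ => 1
  simp only [mul_one, Finset.sum_const, nsmul_eq_mul, card_periods hb] at h
  exact h

theorem utility_eq_sum_periods {T : ℕ} (ω : P.Path T) (y : Fin T → Fin n → ℝ) (t : ℕ)
    (i : Fin n) : P.utility ω y t i = ∑ s ∈ periods T 0 t, P.β (ω s) i * y s i := by
  simp [utility, periods]

theorem utility_mono {T : ℕ} (ω : P.Path T) {y : Fin T → Fin n → ℝ}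
    (hy : ∀ s, y s ∈ stdSimplex ℝ (Fin n)) {a b : ℕ} (hab : a ≤ b) (i : Fin n) :
    P.utility ω y a i ≤ P.utility ω y b i := by
  rw [utility_eq_sum_periods, utility_eq_sum_periods, ← sum_periods_add (Nat.zero_le a) hab]
  exact le_add_of_nonneg_right
    (Finset.sum_nonneg fun s _ => mul_nonneg (P.β_mem _ _).1 ((hy s).1 i))

/-- The utilities after a static policy `ξ` has been followed in the periods `a + 1, …, b`. -/
theorem utility_of_static {T : ℕ} (ω : P.Path T) (y : Fin T → Fin n → ℝ) {a b : ℕ} (hab : a ≤ b)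
    (ξ : Fin P.L → Fin n → ℝ) (h : ∀ s ∈ periods T a b, y s = ξ (ω s)) (i : Fin n) :
    P.utility ω y b i
      = P.utility ω y a i + ∑ ℓ, P.β ℓ i * (P.arrivals ω a b ℓ * ξ ℓ i) := by
  rw [utility_eq_sum_periods, utility_eq_sum_periods, ← sum_periods_add (Nat.zero_le a) hab,
    Finset.sum_congr (s₁ := periods T a b) rfl fun s hs => by rw [h s hs],
    ← P.sum_arrivals_mul ω a b fun ℓ => P.β ℓ i * ξ ℓ i]
  congr 1
  exact Finset.sum_congr rfl fun ℓ _ => by ring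

/-! ### Divisions of the realized arrivals and the fluid problem -/

/-- `z ℓ i` units of type `ℓ` for agent `i` divide the amounts `N ℓ` and, from current utilities
`B`, give every agent at least `v`. -/
def IsDivision (B : Fin n → ℝ) (N : Fin P.L → ℝ) (v : ℝ) (z : Fin P.L → Fin n → ℝ) : Prop :=
  (∀ ℓ i, 0 ≤ z ℓ i) ∧ (∀ ℓ, ∑ i, z ℓ i = N ℓ) ∧ ∀ i, v ≤ B i + ∑ ℓ, P.β ℓ i * z ℓ i

variable {P} {B : Fin n → ℝ} {N : Fin P.L → ℝ} {v : ℝ} {z : Fin P.L → Fin n → ℝ}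

theorem IsDivision.mono (h : P.IsDivision B N v z) {w : ℝ} (hw : w ≤ v) :
    P.IsDivision B N w z :=
  ⟨h.1, h.2.1, fun i => hw.trans (h.2.2 i)⟩

theorem IsDivision.apply_le (h : P.IsDivision B N v z) (ℓ : Fin P.L) (i : Fin n) :
    z ℓ i ≤ N ℓ :=
  h.2.1 ℓ ▸ Finset.single_le_sum (fun i _ => h.1 ℓ i) (Finset.mem_univ i)

/-- A unit is worth at most 1 to any agent. This caps the cost of a bad epoch by the number of
remaining periods. -/
theorem IsDivision.le_add_sum (h : P.IsDivision B N v z) (i : Fin n) : v ≤ B i + ∑ ℓ, N ℓ := by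
  refine (h.2.2 i).trans (add_le_add_right (Finset.sum_le_sum fun ℓ _ => ?_) _)
  have h1 := h.1 ℓ i
  have h2 := h.apply_le ℓ i
  have h3 := P.β_mem ℓ i
  nlinarith [h3.1, h3.2]

/-- A target that everybody already holds survives any division, for instance giving everything to
one agent. This restarts the induction after a bad epoch. -/
theorem exists_isDivision_of_le (hn : 0 < n) (hN : ∀ ℓ, 0 ≤ N ℓ) (hv : ∀ i, v ≤ B i) :
    ∃ z, P.IsDivision B N v z := by
  have hz : ∀ ℓ i, 0 ≤ if i = (⟨0, hn⟩ : Fin n) then N ℓ else 0 := fun ℓ i => by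
    split_ifs
    · exact hN ℓ
    · exact le_rfl
  refine ⟨fun ℓ i => if i = ⟨0, hn⟩ then N ℓ else 0, hz, fun ℓ => by simp, fun i => ?_⟩
  exact (hv i).trans (le_add_of_nonneg_right
    (Finset.sum_nonneg fun ℓ _ => mul_nonneg (P.β_mem ℓ i).1 (hz ℓ i)))

theorem exists_isDivision_of_policy (hn : 0 < n) {T : ℕ} (ω : P.Path T) {y : Fin T → Fin n → ℝ}
    (hy : ∀ s, y s ∈ stdSimplex ℝ (Fin n)) :
    ∃ z, P.IsDivision 0 (P.arrivals ω 0 T) (egalWelfare (P.utility ω y T)) z := by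
  refine ⟨fun ℓ i => ∑ s ∈ periods T 0 T, if ω s = ℓ then y s i else 0, fun ℓ i => ?_,
    fun ℓ => ?_, fun i => ?_⟩
  · refine Finset.sum_nonneg fun s _ => ?_
    split_ifs
    · exact (hy s).1 i
    · exact le_rfl
  · rw [Finset.sum_comm]
    refine Finset.sum_congr rfl fun s _ => ?_
    split_ifs
    · exact (hy s).2
    · simp
  · refine ((le_egalWelfare_iff hn).1 le_rfl i).trans_eq ?_
    rw [utility_eq_sum_periods, Pi.zero_apply, zero_add]
    simp only [Finset.mul_sum]
    rw [Finset.sum_comm]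
    exact Finset.sum_congr rfl fun s _ => by simp

/-- The fluid value is at least any value that is attained with amounts close to the expected
ones, up to the error in the amounts. -/
theorem IsFluidSolution.sub_le_forecast (hn : 0 < n) {τ s : ℝ} {ξ : Fin P.L → Fin n → ℝ}
    (hξ : P.IsFluidSolution B τ ξ) (hz : P.IsDivision B N v z)
    (hN : ∀ ℓ, |N ℓ - P.p ℓ * τ| ≤ s) (i : Fin n) :
    v - P.L * s ≤ P.forecast B τ ξ i := by
  -- Normalize the division to shares; where `N ℓ = 0` the row of `z` vanishes and any point of the
  -- simplex will do.
  let ξ' : Fin P.L → Fin n → ℝ := fun ℓ i =>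
    if N ℓ = 0 then (if i = ⟨0, hn⟩ then 1 else 0) else z ℓ i / N ℓ
  have hN0 : ∀ ℓ, 0 ≤ N ℓ := fun ℓ => (hz.1 ℓ ⟨0, hn⟩).trans (hz.apply_le ℓ _)
  have hξ' : ∀ ℓ, ξ' ℓ ∈ stdSimplex ℝ (Fin n) := by
    intro ℓ
    by_cases h : N ℓ = 0
    · refine ⟨fun i => ?_, ?_⟩
      · simp only [ξ', if_pos h]
        split_ifs <;> norm_num
      · simp [ξ', if_pos h]
    · refine ⟨fun i => ?_, ?_⟩
      · simp only [ξ', if_neg h]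
        exact div_nonneg (hz.1 ℓ i) (hN0 ℓ)
      · simp only [ξ', if_neg h]
        rw [← Finset.sum_div, hz.2.1, div_self h]
  have hle : ∀ ℓ i, z ℓ i - s ≤ P.p ℓ * τ * ξ' ℓ i := by
    intro ℓ i
    have h1 := (hξ' ℓ).1 i
    have h2 := le_one_of_mem_stdSimplex (hξ' ℓ) i
    have h3 := abs_le.1 (hN ℓ)
    have h4 : z ℓ i = N ℓ * ξ' ℓ i := by
      by_cases h : N ℓ = 0
      · have h5 := hz.apply_le ℓ i
        have h6 := hz.1 ℓ i
        rw [h, zero_mul]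
        linarith
      · simp only [ξ', if_neg h]
        field_simp
    rw [h4]
    nlinarith [h3.1, h3.2]
  refine le_trans ?_ ((le_egalWelfare_iff hn).1 (hξ.2 ξ' hξ') i)
  rw [le_egalWelfare_iff hn]
  intro i
  have h1 := hz.2.2 i
  have h2 : ∑ ℓ, (P.β ℓ i * z ℓ i - s) ≤ ∑ ℓ, τ * (P.p ℓ * P.β ℓ i * ξ' ℓ i) := by
    refine Finset.sum_le_sum fun ℓ _ => ?_
    have h3 := hle ℓ i
    have h4 := P.β_mem ℓ i
    have h5 : 0 ≤ s := (abs_nonneg _).trans (hN ℓ)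
    have h6 := mul_le_mul_of_nonneg_left h3 h4.1
    nlinarith [h4.1, h4.2]
  rw [Finset.sum_sub_distrib, ← Finset.mul_sum] at h2
  simp only [Finset.sum_const, Finset.card_univ, Fintype.card_fin, nsmul_eq_mul] at h2
  simp only [forecast]
  linarith

variable (P) in
/-- Any fluid solution lies close to a division of the actual amounts that attains a given
attainable value, uniformly in the current utilities. -/
theorem exists_isDivision_near_fluid (hn : 0 < n) : ∃ κ : ℝ, 0 ≤ κ ∧
    ∀ (B : Fin n → ℝ) (N : Fin P.L → ℝ) (v τ s : ℝ) (ξ : Fin P.L → Fin n → ℝ), 0 ≤ τ → 0 ≤ s →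
      P.IsFluidSolution B τ ξ → (∀ ℓ, |N ℓ - P.p ℓ * τ| ≤ s) →
      (∃ z, P.IsDivision B N v z) →
        ∃ z, P.IsDivision B N v z ∧ ∀ ℓ i, |z ℓ i - P.p ℓ * τ * ξ ℓ i| ≤ κ * s := by
  let σ := Fin P.L × Fin n
  let ι := σ ⊕ (Fin P.L ⊕ (Fin P.L ⊕ Fin n))
  -- The rows are nonnegativity, the two halves of the amount equations, and the welfare
  -- constraints. `B`, `N` and `v` enter only the right-hand side, so `κ` is uniform in them.
  let A : ι → σ → ℝ := Sum.elim (fun q r => if r = q then -1 else 0)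
    (Sum.elim (fun ℓ r => if r.1 = ℓ then 1 else 0)
      (Sum.elim (fun ℓ r => if r.1 = ℓ then -1 else 0)
        fun i r => if r.2 = i then -P.β r.1 i else 0))
  have hA1 : ∀ q (z : σ → ℝ), ∑ r, A (.inl q) r * z r = -z q := fun q z => by
    simp [A]
  have hA2 : ∀ ℓ (z : σ → ℝ), ∑ r, A (.inr (.inl ℓ)) r * z r = ∑ i, z (ℓ, i) := fun ℓ z => by
    simp [A, σ, Fintype.sum_prod_type_right]
  have hA3 : ∀ ℓ (z : σ → ℝ), ∑ r, A (.inr (.inr (.inl ℓ))) r * z r = -∑ i, z (ℓ, i) :=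
    fun ℓ z => by simp [A, σ, Fintype.sum_prod_type_right]
  have hA4 : ∀ i (z : σ → ℝ), ∑ r, A (.inr (.inr (.inr i))) r * z r
      = -∑ ℓ, P.β ℓ i * z (ℓ, i) := fun i z => by
    simp [A, σ, Fintype.sum_prod_type]
  obtain ⟨κ, hκ, H⟩ := hoffmanBound σ ι A
  -- The fluid point violates the amount rows by at most `s` and the welfare rows by at most `P.L *
  -- s`.
  refine ⟨κ * (P.L + 1), by positivity, ?_⟩
  intro B N v τ s ξ hτ hs hξ hN ⟨z, hz⟩
  let b : ι → ℝ := Sum.elim (fun _ => 0) (Sum.elim N (Sum.elim (fun ℓ => -N ℓ) fun i => B i - v))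
  have hiff : ∀ w : σ → ℝ, (∀ j, ∑ r, A j r * w r ≤ b j) ↔
      P.IsDivision B N v fun ℓ i => w (ℓ, i) := by
    intro w
    constructor
    · intro h
      refine ⟨fun ℓ i => ?_, fun ℓ => ?_, fun i => ?_⟩
      · have := (hA1 (ℓ, i) w).symm.trans_le (h _)
        change _ ≤ (0 : ℝ) at this
        linarith
      · have h1 := (hA2 ℓ w).symm.trans_le (h _)
        have h2 := (hA3 ℓ w).symm.trans_le (h _)
        change _ ≤ N ℓ at h1
        change _ ≤ -N ℓ at h2
        linarith
      · have h1 := (hA4 i w).symm.trans_le (h _)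
        change _ ≤ B i - v at h1
        linarith
    · rintro ⟨h1, h2, h3⟩ (q | ℓ | ℓ | i)
      · rw [hA1]
        exact neg_nonpos.2 (h1 q.1 q.2)
      · rw [hA2]
        exact (h2 ℓ).le
      · rw [hA3]
        exact (neg_le_neg_iff.2 (h2 ℓ).ge)
      · rw [hA4]
        change _ ≤ B i - v
        have := h3 i
        linarith
  have hsL : 0 ≤ P.L * s := by positivity
  obtain ⟨w, hw, hwd⟩ := H b (fun r => P.p r.1 * τ * ξ r.1 r.2) ((P.L + 1) * s) (by positivity)
    ⟨fun r => z r.1 r.2, (hiff _).2 hz⟩ (by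
      rintro (q | ℓ | ℓ | i)
      · rw [hA1]
        change _ ≤ 0 + _
        have := mul_nonneg (mul_nonneg (P.p_mem.1 q.1) hτ) ((hξ.1 q.1).1 q.2)
        linarith
      · rw [hA2]
        dsimp only
        rw [← Finset.mul_sum, (hξ.1 ℓ).2]
        change _ ≤ N ℓ + _
        have := abs_le.1 (hN ℓ)
        linarith
      · rw [hA3]
        dsimp only
        rw [← Finset.mul_sum, (hξ.1 ℓ).2]
        change _ ≤ -N ℓ + _
        have := abs_le.1 (hN ℓ)
        linarith
      · rw [hA4]
        change _ ≤ B i - v + _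
        have h1 := hξ.sub_le_forecast hn hz hN i
        have h2 : ∑ ℓ, P.β ℓ i * (P.p ℓ * τ * ξ ℓ i) = τ * ∑ ℓ, P.p ℓ * P.β ℓ i * ξ ℓ i := by
          rw [Finset.mul_sum]
          exact Finset.sum_congr rfl fun ℓ _ => by ring
        simp only [forecast] at h1
        rw [h2]
        linarith)
  exact ⟨_, (hiff w).1 hw, fun ℓ i => by rw [mul_assoc κ]; exact hwd (ℓ, i)⟩

/-- Following the thresholded fluid solution for part of the remaining time keeps `v` attainable,
if the arrivals are close to their expectations. -/
theorem IsDivision.sub_thresholded (hn : 0 < n) {N₁ N₂ : Fin P.L → ℝ} {τ τ' s κ γ : ℝ}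
    {ξ : Fin P.L → Fin n → ℝ} {j : Fin P.L → Fin n}
    (hz : P.IsDivision B N v z) (hN : ∀ ℓ, N₁ ℓ + N₂ ℓ = N ℓ)
    (hs : 0 ≤ s) (hτ : 0 < τ) (hτ' : 0 ≤ τ') (hle : τ' ≤ τ)
    (hγ : γ = τ' / (2 * (n : ℝ) ^ 2 * τ))
    (hξ : ∀ ℓ, ξ ℓ ∈ stdSimplex ℝ (Fin n)) (hj : ∀ ℓ i, ξ ℓ i ≤ ξ ℓ (j ℓ))
    (hclose : ∀ ℓ i, |z ℓ i - P.p ℓ * τ * ξ ℓ i| ≤ κ * s)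
    (hdev : ∀ ℓ, |N₁ ℓ - P.p ℓ * (τ - τ')| ≤ s)
    (hgap : ∀ ℓ, N₁ ℓ = 0 ∨ (κ + 1) * s ≤ P.p ℓ * (τ' * γ)) :
    P.IsDivision (fun i => B i + ∑ ℓ, P.β ℓ i * (N₁ ℓ * thresholded γ (j ℓ) (ξ ℓ) i)) N₂ v
      fun ℓ i => z ℓ i - N₁ ℓ * thresholded γ (j ℓ) (ξ ℓ) i := by
  have hn1 : (1 : ℝ) ≤ n := by exact_mod_cast hn
  have hγ0 : 0 ≤ γ := by rw [hγ]; positivity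
  refine ⟨fun ℓ i => ?_, fun ℓ => ?_, fun i => ?_⟩
  · rcases hgap ℓ with h0 | hgap
    · dsimp only
      rw [h0, zero_mul, sub_zero]
      exact hz.1 ℓ i
    rw [sub_nonneg]
    have hp := P.p_mem.1 ℓ
    have hd := (abs_le.1 (hdev ℓ)).2
    have hc := (abs_le.1 (hclose ℓ i)).1
    have ht0 := (thresholded_mem_stdSimplex (γ := γ) (j := j ℓ) (hξ ℓ)).1 i
    have ht1 := le_one_of_mem_stdSimplex
      (thresholded_mem_stdSimplex (γ := γ) (j := j ℓ) (hξ ℓ)) i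
    have hN1 : N₁ ℓ * thresholded γ (j ℓ) (ξ ℓ) i
        ≤ P.p ℓ * (τ - τ') * thresholded γ (j ℓ) (ξ ℓ) i + s := by
      nlinarith
    have hpτ' : 0 ≤ P.p ℓ * τ' := mul_nonneg hp hτ'
    -- The largest share is at least `1 / n`. Half of the `p * τ' / n` it leaves pays for the
    -- collected shares, as `n * γ * τ = τ' / (2 * n)`; the other half is at least `p * τ' * γ` and
    -- absorbs the error. This explains the factor `2 * n ^ 2` in `γ`.
    by_cases hij : i = j ℓ
    · subst hij
      have h1 := thresholded_self_le (j := j ℓ) hγ0 (hξ ℓ)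
      have hmax : 1 ≤ n * ξ ℓ (j ℓ) := by
        rw [← (hξ ℓ).2]
        refine (Finset.sum_le_sum fun i _ => hj ℓ i).trans_eq ?_
        simp
      have hγn : n * γ * τ = τ' * (1 / (2 * n)) := by
        rw [hγ]
        field_simp
      have hγle : γ ≤ 1 / (2 * n) := by
        rw [hγ, div_le_div_iff₀ (by positivity) (by positivity)]
        nlinarith [mul_le_mul hle hn1 zero_le_one hτ.le, mul_pos hτ (by positivity : (0:ℝ) < n)]
      have hξj : 1 / (2 * n) + 1 / (2 * n) ≤ ξ ℓ (j ℓ) := by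
        have : (1 : ℝ) / (2 * n) + 1 / (2 * n) = 1 / n := by field_simp; norm_num
        rw [this, div_le_iff₀ (by positivity)]
        linarith
      have h2 : P.p ℓ * (τ - τ') * thresholded γ (j ℓ) (ξ ℓ) (j ℓ)
          ≤ P.p ℓ * (τ - τ') * ξ ℓ (j ℓ) + P.p ℓ * (n * γ * τ) := by
        have h3 : 0 ≤ P.p ℓ * (τ - τ') := mul_nonneg hp (by linarith)
        have h4 := mul_le_mul_of_nonneg_left h1 h3
        have h5 : 0 ≤ P.p ℓ * τ' * (n * γ) := by positivity
        nlinarith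
      rw [hγn] at h2
      have h3 := mul_le_mul_of_nonneg_left hξj hpτ'
      have h4 := mul_le_mul_of_nonneg_left hγle hpτ'
      nlinarith
    · have heq : thresholded γ (j ℓ) (ξ ℓ) i = if γ ≤ ξ ℓ i then ξ ℓ i else 0 := if_neg hij
      by_cases hγi : γ ≤ ξ ℓ i
      · rw [if_pos hγi] at heq
        rw [heq] at hN1 ⊢
        have h4 := mul_le_mul_of_nonneg_left hγi hpτ'
        nlinarith
      · rw [heq, if_neg hγi, mul_zero]
        exact hz.1 ℓ i
  · rw [Finset.sum_sub_distrib, hz.2.1, ← Finset.mul_sum, sum_thresholded, ← hN]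
    ring
  · refine (hz.2.2 i).trans_eq ?_
    simp only [mul_sub, Finset.sum_sub_distrib]
    ring

end AdmissibleDist

/-! ### Concentration of the arrival counts -/

namespace AdmissibleDist

variable {n : ℕ} (P : AdmissibleDist n)

instance instIsProbabilityMeasurePathLaw (T : ℕ) : IsProbabilityMeasure (P.pathLaw T) := by
  unfold pathLaw
  infer_instance

theorem integral_typeLaw (f : Fin P.L → ℝ) : ∫ ℓ, f ℓ ∂P.typeLaw = ∑ ℓ, P.p ℓ * f ℓ := by
  unfold typeLaw
  rw [integral_finsetSum_measure fun ℓ _ =>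
    (integrable_dirac (by simp)).smul_measure ENNReal.ofReal_ne_top]
  refine Finset.sum_congr rfl fun ℓ _ => ?_
  rw [integral_smul_measure, integral_dirac, ENNReal.toReal_ofReal (P.p_mem.1 ℓ), smul_eq_mul]

theorem integral_pathLaw_eval {T : ℕ} (t : Fin T) (f : Fin P.L → ℝ) :
    ∫ ω, f (ω t) ∂P.pathLaw T = ∑ ℓ, P.p ℓ * f ℓ := by
  rw [← integral_typeLaw, ← (measurePreserving_eval (fun _ : Fin T => P.typeLaw) t).map_eq,
    integral_map (measurable_pi_apply t).aemeasurable
      (measurable_of_finite f).aestronglyMeasurable]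
  rfl

/-- Types of probability zero would leave no slack `p * τ' * γ`, so they are excluded almost surely.
-/
theorem ae_p_ne_zero (T : ℕ) : ∀ᵐ ω ∂P.pathLaw T, ∀ s, P.p (ω s) ≠ 0 := by
  rw [ae_all_iff]
  intro s
  have h : ∀ᵐ ℓ ∂P.typeLaw, P.p ℓ ≠ 0 := by
    rw [ae_iff]
    simp only [typeLaw, Measure.coe_finsetSum, Finset.sum_apply, Measure.smul_apply, smul_eq_mul]
    refine Finset.sum_eq_zero fun ℓ _ => ?_
    by_cases hp : P.p ℓ = 0
    · simp [hp]
    · simp [hp]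
  exact (Measure.quasiMeasurePreserving_eval (fun _ : Fin T => P.typeLaw) s).ae h

theorem hasSubgaussianMGF_arrival {T : ℕ} (t : Fin T) (ℓ : Fin P.L) :
    ProbabilityTheory.HasSubgaussianMGF
      (fun ω : P.Path T => (if ω t = ℓ then (1 : ℝ) else 0) - P.p ℓ) (1 / 4) (P.pathLaw T) := by
  have h := ProbabilityTheory.hasSubgaussianMGF_of_mem_Icc (μ := P.pathLaw T) (a := 0) (b := 1)
    (X := fun ω : P.Path T => if ω t = ℓ then (1 : ℝ) else 0)
    (measurable_of_finite _).aemeasurable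
    (Filter.Eventually.of_forall fun ω => by split_ifs <;> norm_num)
  rw [P.integral_pathLaw_eval t fun ℓ' => if ℓ' = ℓ then (1 : ℝ) else 0] at h
  have h4 : ((‖(1 : ℝ) - 0‖₊ / 2) ^ 2 : NNReal) = 1 / 4 := by
    rw [sub_zero, nnnorm_one]
    norm_num
  rw [h4] at h
  simpa using h

theorem iIndepFun_arrival (T : ℕ) (g : Fin P.L → ℝ) :
    ProbabilityTheory.iIndepFun (fun (t : Fin T) (ω : P.Path T) => g (ω t)) (P.pathLaw T) :=
  ProbabilityTheory.iIndepFun_pi (X := fun _ => g) fun _ => (measurable_of_finite g).aemeasurable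

/-- **Hoeffding's inequality** for the number of arrivals of a type. -/
theorem measureReal_arrivals_deviation_le {T a b : ℕ} (hab : a ≤ b) (hb : b ≤ T) (ℓ : Fin P.L)
    {s τ : ℝ} (hs : 0 < s) (hτ : (b : ℝ) - a ≤ τ) :
    (P.pathLaw T).real {ω | s < |P.arrivals ω a b ℓ - P.p ℓ * (b - a)|}
      ≤ 2 * Real.exp (-(2 * s ^ 2 / τ)) := by
  have hcast : ((b - a : ℕ) : ℝ) = b - a := Nat.cast_sub hab
  rcases hab.eq_or_lt with rfl | hlt
  · have : {ω : P.Path T | s < |P.arrivals ω a a ℓ - P.p ℓ * (a - a)|} = ∅ := by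
      ext ω
      have h0 : periods T a a = ∅ := Finset.card_eq_zero.1 (by rw [card_periods hb]; simp)
      simp [arrivals, h0, hs.le]
    rw [this, measureReal_empty]
    positivity
  have hm : (0 : ℝ) < b - a := sub_pos.2 (Nat.cast_lt.2 hlt)
  set X : Fin T → P.Path T → ℝ := fun t ω => (if ω t = ℓ then (1 : ℝ) else 0) - P.p ℓ with hX
  have hsum : ∀ ω, ∑ t ∈ periods T a b, X t ω = P.arrivals ω a b ℓ - P.p ℓ * (b - a) := by
    intro ω
    simp only [hX, Finset.sum_sub_distrib, Finset.sum_const, nsmul_eq_mul, card_periods hb, hcast,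
      arrivals]
    ring
  have hvar : ∑ t ∈ periods T a b, ((fun _ => 1 / 4 : Fin T → NNReal) t : ℝ) = (b - a) / 4 := by
    simp only [Finset.sum_const, nsmul_eq_mul, card_periods hb, hcast]
    push_cast
    ring
  -- Replacing the window length by its upper bound `τ` lets windows of different lengths share one
  -- tail bound.
  have hexp : Real.exp (-s ^ 2 / (2 * ((b - a) / 4))) ≤ Real.exp (-(2 * s ^ 2 / τ)) := by
    rw [Real.exp_le_exp, show -s ^ 2 / (2 * (((b : ℝ) - a) / 4)) = -(2 * s ^ 2 / (b - a)) by
      field_simp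
      ring, neg_le_neg_iff]
    exact div_le_div_of_nonneg_left (by positivity) hm hτ
  have hup := ProbabilityTheory.HasSubgaussianMGF.measure_sum_ge_le_of_iIndepFun
    (P.iIndepFun_arrival T fun ℓ' => (if ℓ' = ℓ then (1 : ℝ) else 0) - P.p ℓ)
    (s := periods T a b) (fun t _ => P.hasSubgaussianMGF_arrival t ℓ) hs.le
  have hdown := ProbabilityTheory.HasSubgaussianMGF.measure_sum_ge_le_of_iIndepFun
    (P.iIndepFun_arrival T fun ℓ' => -((if ℓ' = ℓ then (1 : ℝ) else 0) - P.p ℓ))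
    (s := periods T a b) (fun t _ => (P.hasSubgaussianMGF_arrival t ℓ).neg) hs.le
  push_cast at hup hdown hvar
  rw [hvar] at hup hdown
  have hsub : {ω : P.Path T | s < |P.arrivals ω a b ℓ - P.p ℓ * (b - a)|} ⊆
      {ω | s ≤ ∑ t ∈ periods T a b, X t ω} ∪ {ω | s ≤ ∑ t ∈ periods T a b, -X t ω} := by
    intro ω hω
    simp only [Set.mem_union, Set.mem_ofPred_eq, Finset.sum_neg_distrib, hsum] at hω ⊢
    exact (lt_abs.1 hω).imp le_of_lt le_of_lt
  refine (measureReal_mono hsub).trans ((measureReal_union_le _ _).trans ?_)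
  linarith

end AdmissibleDist

/-! ### Re-solving times -/

section ResolveTimes

variable {η : ℝ} {T : ℕ}

theorem le_exp_pow_numResolves (hη : 1 < η) (T : ℕ) :
    (T : ℝ) ≤ Real.exp (η ^ numResolves η T) := by
  refine (Real.le_exp_log _).trans (Real.exp_le_exp.2 ?_)
  have hlog : 0 < Real.log η := Real.log_pos hη
  -- For `T ≤ 1` the iterated logarithm carries no information, but the bound is trivial.
  rcases le_or_gt (Real.log T) 0 with h | h
  · exact h.trans (by positivity)
  · have h1 := Nat.le_ceil (Real.log (Real.log T) / Real.log η)
    rw [div_le_iff₀ hlog, ← Real.log_pow, Real.log_le_log_iff h (by positivity)] at h1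
    exact h1

/-- Guarantees that the natural subtraction in `resolveTime` does not truncate. -/
theorem exp_pow_le_of_lt_numResolves (hη : 1 < η) {m : ℕ} (hm : m < numResolves η T) :
    Real.exp (η ^ m) ≤ T := by
  have hlog : 0 < Real.log η := Real.log_pos hη
  have h1 := Nat.lt_ceil.1 hm
  rw [lt_div_iff₀ hlog] at h1
  have h2 : 0 < Real.log (Real.log T) := lt_of_le_of_lt (by positivity) h1
  have h3 : 0 < Real.log T := by
    refine (Real.log_natCast_nonneg T).lt_of_ne fun h => ?_
    rw [← h, Real.log_zero] at h2
    exact h2.false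
  have h4 : (0 : ℝ) < T := by
    refine (Nat.cast_nonneg T).lt_of_ne fun h => ?_
    rw [← h, Real.log_zero] at h3
    exact h3.false
  rw [← Real.log_pow, Real.log_lt_log_iff (by positivity) h3] at h1
  exact (Real.le_log_iff_exp_le h4).1 h1.le

theorem resolveTime_zero (η : ℝ) (T : ℕ) : resolveTime η T 0 = 0 := if_pos rfl

theorem resolveTime_le (η : ℝ) (T k : ℕ) : resolveTime η T k ≤ T := by
  unfold resolveTime
  split_ifs <;> omega

theorem resolveTime_of_numResolves_lt {k : ℕ} (hk : numResolves η T < k) :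
    resolveTime η T k = T := by
  rw [resolveTime, if_neg (by omega), if_neg (by omega)]

theorem sub_resolveTime (hη : 1 < η) {k : ℕ} (hk0 : k ≠ 0) (hk : k ≤ numResolves η T) :
    (T : ℝ) - resolveTime η T k = ⌊Real.exp (η ^ (numResolves η T - k))⌋₊ := by
  rw [resolveTime, if_neg hk0, if_pos hk, Nat.cast_sub, sub_sub_cancel]
  exact Nat.floor_le_of_le (exp_pow_le_of_lt_numResolves hη (by omega))

theorem sub_resolveTime_le_exp (hη : 1 < η) {k : ℕ} (hk : k ≤ numResolves η T) :
    (T : ℝ) - resolveTime η T k ≤ Real.exp (η ^ (numResolves η T - k)) := by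
  rcases eq_or_ne k 0 with rfl | hk0
  · rw [resolveTime_zero, Nat.cast_zero, sub_zero, Nat.sub_zero]
    exact le_exp_pow_numResolves hη T
  · rw [sub_resolveTime hη hk0 hk]
    exact Nat.floor_le (Real.exp_pos _).le

/-- The floor loses less than 1, and the exponential is at least 2. At `k = 0` all `T` periods
remain, which may be far fewer than `exp (η ^ K)`. -/
theorem half_exp_le_sub_resolveTime (hη : 1 < η) {k : ℕ} (hk0 : k ≠ 0)
    (hk : k ≤ numResolves η T) :
    Real.exp (η ^ (numResolves η T - k)) / 2 ≤ (T : ℝ) - resolveTime η T k := by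
  rw [sub_resolveTime hη hk0 hk]
  have h1 := Nat.lt_floor_add_one (Real.exp (η ^ (numResolves η T - k)))
  have h2 := Real.add_one_le_exp (η ^ (numResolves η T - k))
  have h3 : 1 ≤ η ^ (numResolves η T - k) := one_le_pow₀ hη.le
  linarith

theorem resolveTime_le_succ (hη : 1 < η) (k : ℕ) :
    resolveTime η T k ≤ resolveTime η T (k + 1) := by
  rcases Nat.eq_zero_or_pos k with rfl | hk
  · rw [resolveTime_zero]
    exact Nat.zero_le _
  rcases lt_or_ge k (numResolves η T) with h | h
  · rw [resolveTime, resolveTime, if_neg hk.ne', if_pos h.le, if_neg (by omega),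
      if_pos (Nat.succ_le_of_lt h)]
    refine Nat.sub_le_sub_left (Nat.floor_le_floor (Real.exp_le_exp.2 ?_)) T
    exact pow_le_pow_right₀ hη.le (by omega)
  · rw [resolveTime_of_numResolves_lt (k := k + 1) (by omega)]
    exact resolveTime_le _ _ _

theorem exists_epoch (η : ℝ) {s : ℕ} (hs : s < T) :
    ∃ k ≤ numResolves η T, resolveTime η T k ≤ s ∧ s < resolveTime η T (k + 1) := by
  by_contra! h
  have : ∀ k ≤ numResolves η T + 1, resolveTime η T k ≤ s := by
    intro k
    induction k with
    | zero => exact fun _ => by rw [resolveTime_zero]; exact Nat.zero_le _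
    | succ k ih => exact fun hk => h k (by omega) (ih (by omega))
  have h1 := this _ le_rfl
  rw [resolveTime_of_numResolves_lt (Nat.lt_succ_self _)] at h1
  omega

end ResolveTimes

/-! ### Summability over epochs -/

/-- A bound for the expected loss in the epoch with `η ^ m` in the exponent of the remaining time
after it. -/
noncomputable def epochBound (η c : ℝ) (m : ℕ) : ℝ :=
  Real.exp (η ^ (m + 1)) * Real.exp (-(c * Real.exp ((4 - 3 * η) * η ^ m)))

/-- With `u = η ^ m` and `a = 4 - 3 * η > 0`, use `exp (a * u) ≥ (a * u) ^ 2 / 2`. Even after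
multiplication by `u ≤ exp u` the exponent is at most `(η + 1) * u - c * a ^ 2 * u ^ 2 / 2`, whose
maximum is the constant below; what remains is a geometric series in `η⁻¹`. -/
theorem summable_epochBound {η c : ℝ} (hη : 1 < η) (hη' : η < 4 / 3) (hc : 0 < c) :
    Summable (epochBound η c) := by
  set a := 4 - 3 * η with ha
  have ha0 : 0 < a := by linarith
  have hη0 : 0 < η := by linarith
  refine Summable.of_nonneg_of_le (fun m => by unfold epochBound; positivity) (fun m => ?_)
    ((summable_geometric_of_lt_one (inv_nonneg.2 hη0.le) (inv_lt_one_of_one_lt₀ hη)).mul_left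
      (Real.exp ((η + 1) ^ 2 / (2 * (c * a ^ 2)))))
  rw [epochBound, inv_pow, ← div_eq_mul_inv, le_div_iff₀ (by positivity)]
  have h1 := Real.add_one_le_exp (η ^ m)
  have h2 := Real.quadratic_le_exp_of_nonneg (x := a * η ^ m) (by positivity)
  have hu : 0 ≤ η ^ m := by positivity
  rw [← Real.exp_add]
  refine (mul_le_mul_of_nonneg_left ((le_add_of_nonneg_right zero_le_one).trans h1)
    (Real.exp_pos _).le).trans ?_
  rw [← Real.exp_add, Real.exp_le_exp, le_div_iff₀ (by positivity), pow_succ]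
  have h3 : c * ((a * η ^ m) ^ 2 / 2) ≤ c * Real.exp (a * η ^ m) := by
    apply mul_le_mul_of_nonneg_left _ hc.le
    have : 0 ≤ a * η ^ m := by positivity
    linarith
  set u := η ^ m
  have h4 : u * η + -(c * Real.exp (a * u)) + u ≤ (η + 1) * u - c * ((a * u) ^ 2 / 2) := by
    linarith
  refine (mul_le_mul_of_nonneg_right h4 (by positivity)).trans ?_
  nlinarith [sq_nonneg (c * a ^ 2 * u - (η + 1))]

/-- The tail bound for one epoch in terms of the remaining times before and after it. -/
theorem mul_exp_le_epochBound {η c τ τ' : ℝ} {m : ℕ} (hτ : 0 < τ)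
    (hτle : τ ≤ Real.exp (η ^ (m + 1))) (hτ' : Real.exp (η ^ m) / 2 ≤ τ') :
    τ * Real.exp (-(2 * (c * τ' ^ 2 / τ) ^ 2 / τ)) ≤ epochBound η (c ^ 2 / 8) m := by
  refine mul_le_mul hτle (Real.exp_le_exp.2 (neg_le_neg ?_)) (Real.exp_pos _).le
    (Real.exp_pos _).le
  have h1 : (Real.exp (η ^ m) / 2) ^ 4 ≤ τ' ^ 4 :=
    pow_le_pow_left₀ (by positivity) hτ' 4
  have h2 : τ ^ 3 ≤ Real.exp (η ^ (m + 1)) ^ 3 := pow_le_pow_left₀ hτ.le hτle 3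
  -- The exponent `4 - 3 * η` comes from `τ' ^ 4 / τ ^ 3`; the constant is `2 * c ^ 2 / 2 ^ 4 = c ^
  -- 2 / 8`.
  have h3 : Real.exp ((4 - 3 * η) * η ^ m)
      = Real.exp (η ^ m) ^ 4 / Real.exp (η ^ (m + 1)) ^ 3 := by
    rw [← Real.exp_nat_mul, ← Real.exp_nat_mul, ← Real.exp_sub]
    congr 1
    push_cast
    ring
  have h4 : 2 * (c * τ' ^ 2 / τ) ^ 2 / τ = 2 * c ^ 2 * (τ' ^ 4 / τ ^ 3) := by
    field_simp
  have h5 : (Real.exp (η ^ m) / 2) ^ 4 / Real.exp (η ^ (m + 1)) ^ 3 ≤ τ' ^ 4 / τ ^ 3 :=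
    div_le_div₀ (by positivity) h1 (by positivity) h2
  rw [h4, h3]
  refine le_trans (le_of_eq ?_) (mul_le_mul_of_nonneg_left h5 (by positivity))
  ring

/-! ### Pathwise loss and regret -/

namespace AdmissibleDist

variable {n : ℕ} {P : AdmissibleDist n}

theorem IsBIRT.mem_stdSimplex {η : ℝ} {T : ℕ} {x : P.Policy T} (hx : P.IsBIRT η x)
    (ω : P.Path T) (s : Fin T) : x ω s ∈ stdSimplex ℝ (Fin n) := by
  obtain ⟨ξ, j, h⟩ := hx
  obtain ⟨k, hk, h1, h2⟩ := exists_epoch η s.2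
  obtain ⟨hfluid, -, halloc⟩ := (h k hk).2 ω
  rw [halloc s h1 h2]
  exact thresholded_mem_stdSimplex (hfluid.1 _)

theorem utility_le {T : ℕ} (ω : P.Path T) {y : Fin T → Fin n → ℝ}
    (hy : ∀ s, y s ∈ stdSimplex ℝ (Fin n)) (i : Fin n) : P.utility ω y T i ≤ T := by
  rw [utility_eq_sum_periods]
  calc ∑ s ∈ periods T 0 T, P.β (ω s) i * y s i ≤ ∑ _s ∈ periods T 0 T, (1 : ℝ) :=
        Finset.sum_le_sum fun s _ =>
          mul_le_one₀ (P.β_mem _ i).2 ((hy s).1 i) (le_one_of_mem_stdSimplex (hy s) i)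
    _ = T := by simp [card_periods le_rfl]

theorem egalWelfare_le_hindsightOpt (hn : 0 < n) {T : ℕ} (ω : P.Path T)
    {y : Fin T → Fin n → ℝ} (hy : ∀ s, y s ∈ stdSimplex ℝ (Fin n)) :
    egalWelfare (P.utility ω y T) ≤ P.hindsightOpt ω := by
  refine le_csSup ⟨T, ?_⟩ ⟨y, hy, rfl⟩
  rintro _ ⟨y', hy', rfl⟩
  exact ((le_egalWelfare_iff hn).1 le_rfl ⟨0, hn⟩).trans (utility_le ω hy' _)

variable (P) in
/-- The arrivals from epoch `k` on deviate from their expectations by more than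
`c τ' ^ 2 / τ`, where `τ` and `τ'` periods remain before and after the epoch. -/
def deviationEvent (η c : ℝ) (T k : ℕ) : Set (P.Path T) :=
  {ω | ∃ ℓ,
    c * ((T : ℝ) - resolveTime η T (k + 1)) ^ 2 / ((T : ℝ) - resolveTime η T k) <
        |P.arrivals ω (resolveTime η T k) T ℓ - P.p ℓ * ((T : ℝ) - resolveTime η T k)| ∨
    c * ((T : ℝ) - resolveTime η T (k + 1)) ^ 2 / ((T : ℝ) - resolveTime η T k) <
        |P.arrivals ω (resolveTime η T k) (resolveTime η T (k + 1)) ℓ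
          - P.p ℓ * ((resolveTime η T (k + 1) : ℝ) - resolveTime η T k)|}

variable (P) in
-- The event concerns the arrivals in two deterministic windows, so Hoeffding applies without
-- conditioning; types, windows and two tails give the factor `P.L * 4`.
theorem mul_measureReal_deviationEvent_le {η c : ℝ} (hη : 1 < η) (hc : 0 < c) {T k : ℕ}
    (hk : k < numResolves η T) :
    ((T : ℝ) - resolveTime η T k) * (P.pathLaw T).real (P.deviationEvent η c T k)
      ≤ P.L * 4 * epochBound η (c ^ 2 / 8) (numResolves η T - (k + 1)) := by
  have hmono := resolveTime_le_succ (T := T) hη k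
  have hT := resolveTime_le η T (k + 1)
  have hτ' := half_exp_le_sub_resolveTime (T := T) hη (Nat.succ_ne_zero k) hk
  have hτle := sub_resolveTime_le_exp hη hk.le
  rw [show numResolves η T - k = numResolves η T - (k + 1) + 1 by omega] at hτle
  have hmono' : (resolveTime η T k : ℝ) ≤ resolveTime η T (k + 1) := Nat.cast_le.2 hmono
  have hT' : (resolveTime η T (k + 1) : ℝ) ≤ T := Nat.cast_le.2 hT
  have hτ'0 : 0 < (T : ℝ) - resolveTime η T (k + 1) :=
    (half_pos (Real.exp_pos _)).trans_le hτ'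
  have hτ0 : 0 < (T : ℝ) - resolveTime η T k := by linarith
  have hb := mul_exp_le_epochBound (c := c) hτ0 hτle hτ'
  set s := c * ((T : ℝ) - resolveTime η T (k + 1)) ^ 2 / ((T : ℝ) - resolveTime η T k) with hs
  have hs0 : 0 < s := by positivity
  have hsub : P.deviationEvent η c T k ⊆ ⋃ ℓ : Fin P.L,
      ({ω | s < |P.arrivals ω (resolveTime η T k) T ℓ
          - P.p ℓ * ((T : ℝ) - resolveTime η T k)|} ∪
        {ω | s < |P.arrivals ω (resolveTime η T k) (resolveTime η T (k + 1)) ℓ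
          - P.p ℓ * ((resolveTime η T (k + 1) : ℝ) - resolveTime η T k)|}) := by
    rintro ω ⟨ℓ, h⟩
    exact Set.mem_iUnion.2 ⟨ℓ, h⟩
  have hprob : (P.pathLaw T).real (P.deviationEvent η c T k)
      ≤ P.L * 4 * Real.exp (-(2 * s ^ 2 / ((T : ℝ) - resolveTime η T k))) := by
    refine (measureReal_mono hsub).trans ((measureReal_iUnion_fintype_le _).trans ?_)
    refine (Finset.sum_le_sum fun ℓ _ => (measureReal_union_le _ _).trans (add_le_add
      (P.measureReal_arrivals_deviation_le (hmono.trans hT) le_rfl ℓ hs0 le_rfl)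
      (P.measureReal_arrivals_deviation_le hmono hT ℓ hs0 (sub_le_sub_right hT' _)))).trans_eq ?_
    simp only [Finset.sum_const, Finset.card_univ, Fintype.card_fin, nsmul_eq_mul]
    ring
  calc _ ≤ ((T : ℝ) - resolveTime η T k)
        * (P.L * 4 * Real.exp (-(2 * s ^ 2 / ((T : ℝ) - resolveTime η T k)))) :=
        mul_le_mul_of_nonneg_left hprob hτ0.le
    _ = P.L * 4 * (((T : ℝ) - resolveTime η T k)
        * Real.exp (-(2 * s ^ 2 / ((T : ℝ) - resolveTime η T k)))) := by ring
    _ ≤ _ := mul_le_mul_of_nonneg_left hb (by positivity)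

variable (P) in
theorem exists_pos_le_p : ∃ q > 0, ∀ ℓ, P.p ℓ ≠ 0 → q ≤ P.p ℓ := by
  have : ∀ᶠ q in nhdsWithin (0 : ℝ) (Set.Ioi 0), ∀ ℓ, P.p ℓ ≠ 0 → q ≤ P.p ℓ := by
    refine Filter.eventually_all.2 fun ℓ => ?_
    by_cases h : P.p ℓ = 0
    · simp [h]
    · have hpos := (P.p_mem.1 ℓ).lt_of_ne' h
      filter_upwards [nhdsWithin_le_nhds (Iio_mem_nhds hpos)] with q hq _ using hq.le
  obtain ⟨q, hq, hq0⟩ := (this.and self_mem_nhdsWithin).exists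
  exact ⟨q, hq0, hq⟩

variable (P) in
/-- In an epoch without a large deviation the policy keeps every attainable value attainable. -/
theorem exists_isDivision_succ {η : ℝ} (hn : 0 < n) (hη : 1 < η) :
    ∃ c > 0, ∀ (T : ℕ) (x : P.Policy T), P.IsBIRT η x → ∀ ω : P.Path T,
      (∀ s, P.p (ω s) ≠ 0) → ∀ k < numResolves η T, ω ∉ P.deviationEvent η c T k → ∀ v,
      (∃ z, P.IsDivision (P.utility ω (x ω) (resolveTime η T k))
        (P.arrivals ω (resolveTime η T k) T) v z) →
      ∃ z, P.IsDivision (P.utility ω (x ω) (resolveTime η T (k + 1)))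
        (P.arrivals ω (resolveTime η T (k + 1)) T) v z := by
  obtain ⟨κ, hκ, hnear⟩ := P.exists_isDivision_near_fluid hn
  obtain ⟨q, hq, hqp⟩ := P.exists_pos_le_p
  have hn0 : (0 : ℝ) < n := Nat.cast_pos.2 hn
  -- Chosen so that `(κ + 1) * s = q * τ' * γ_k`, exactly the slack of a type of probability `q`.
  refine ⟨q / (2 * n ^ 2 * (κ + 1)), by positivity, ?_⟩
  rintro T x ⟨ξ, j, hx⟩ ω hω k hk hdev v hz
  have hmono := resolveTime_le_succ (T := T) hη k
  have hT := resolveTime_le η T (k + 1)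
  have hmono' : (resolveTime η T k : ℝ) ≤ resolveTime η T (k + 1) := Nat.cast_le.2 hmono
  have hτ'0 : 0 < (T : ℝ) - resolveTime η T (k + 1) :=
    (half_pos (Real.exp_pos _)).trans_le (half_exp_le_sub_resolveTime hη (Nat.succ_ne_zero k) hk)
  obtain ⟨hfluid, hj, halloc⟩ := (hx k hk.le).2 ω
  simp only [deviationEvent, Set.mem_ofPred_eq, not_exists, not_or, not_lt] at hdev
  set τ := (T : ℝ) - resolveTime η T k with hτ
  set τ' := (T : ℝ) - resolveTime η T (k + 1) with hτ'
  have hle : τ' ≤ τ := by linarith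
  have hτ0 : 0 < τ := hτ'0.trans_le hle
  set s := q / (2 * n ^ 2 * (κ + 1)) * τ' ^ 2 / τ with hs
  have hs0 : 0 ≤ s := by positivity
  obtain ⟨z, hz, hclose⟩ := hnear _ _ v τ s _ hτ0.le hs0 hfluid (fun ℓ => (hdev ℓ).1) hz
  have hgap : ∀ ℓ, P.arrivals ω (resolveTime η T k) (resolveTime η T (k + 1)) ℓ = 0 ∨
      (κ + 1) * s ≤ P.p ℓ * (τ' * resolveThreshold n η T k) := by
    intro ℓ
    by_cases hp : P.p ℓ = 0
    · left
      refine Finset.sum_eq_zero fun t _ => if_neg ?_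
      rintro rfl
      exact hω t hp
    · right
      have h1 : (κ + 1) * s = q * (τ' * resolveThreshold n η T k) := by
        rw [resolveThreshold, if_pos hk, hs, ← hτ, ← hτ']
        field_simp
      rw [h1]
      refine mul_le_mul_of_nonneg_right (hqp ℓ hp) (mul_nonneg hτ'0.le ?_)
      rw [resolveThreshold, if_pos hk, ← hτ, ← hτ']
      positivity
  have hstep := hz.sub_thresholded (τ' := τ') hn (fun ℓ => arrivals_add ω hmono hT ℓ) hs0 hτ0
    hτ'0.le hle (if_pos hk) hfluid.1 hj hclose (fun ℓ => by
      rw [show τ - τ' = (resolveTime η T (k + 1) : ℝ) - resolveTime η T k by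
        rw [hτ, hτ']
        ring]
      exact (hdev ℓ).2) hgap
  have hutil : P.utility ω (x ω) (resolveTime η T (k + 1)) = _ := funext fun i =>
    P.utility_of_static ω (x ω) hmono
      (fun ℓ => thresholded (resolveThreshold n η T k) (j k ω ℓ) (ξ k ω ℓ))
      (fun s hs => halloc s (mem_periods.1 hs).1 (mem_periods.1 hs).2) i
  rw [hutil]
  exact ⟨_, hstep⟩

variable (P) in
/-- The pathwise loss is bounded by the sum of the remaining times at the epochs with a large
deviation. -/
theorem hindsightOpt_sub_le {η : ℝ} (hn : 0 < n) (hη : 1 < η) :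
    ∃ c > 0, ∀ (T : ℕ) (x : P.Policy T), P.IsBIRT η x → ∀ ω : P.Path T,
      (∀ s, P.p (ω s) ≠ 0) →
      P.hindsightOpt ω - egalWelfare (P.utility ω (x ω) T) ≤ Real.exp 1 +
        ∑ k ∈ Finset.range (numResolves η T), ((T : ℝ) - resolveTime η T k)
          * (P.deviationEvent η c T k).indicator 1 ω := by
  obtain ⟨c, hc, hstep⟩ := P.exists_isDivision_succ hn hη
  refine ⟨c, hc, fun T x hx ω hω => ?_⟩
  have hfeas := hx.mem_stdSimplex ω
  have hloss : ∀ t ≤ T, ∀ i v, (∃ z, P.IsDivision (P.utility ω (x ω) t)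
      (P.arrivals ω t T) v z) → v ≤ P.utility ω (x ω) t i + ((T : ℝ) - t) := by
    rintro t ht i v ⟨z, hz⟩
    have h := hz.le_add_sum i
    rwa [P.sum_arrivals ω le_rfl, Nat.cast_sub ht] at h
  -- Invariant: the benchmark welfare, lowered by `τ` for each bad epoch so far, is attainable at
  -- `t_k`.
  suffices ∀ y : Fin T → Fin n → ℝ, (∀ s, y s ∈ stdSimplex ℝ (Fin n)) →
      ∀ k ≤ numResolves η T, ∃ z, P.IsDivision (P.utility ω (x ω) (resolveTime η T k))
        (P.arrivals ω (resolveTime η T k) T)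
        (egalWelfare (P.utility ω y T) - ∑ i ∈ Finset.range k,
          ((T : ℝ) - resolveTime η T i) * (P.deviationEvent η c T i).indicator 1 ω) z by
    rw [sub_le_iff_le_add]
    refine csSup_le ⟨_, x ω, hfeas, rfl⟩ ?_
    rintro _ ⟨y, hy, rfl⟩
    dsimp only
    rw [add_comm, ← sub_le_iff_le_add, ← sub_sub, sub_right_comm, le_egalWelfare_iff hn]
    intro i
    have h1 := hloss _ (resolveTime_le _ _ _) i _ (this y hy _ le_rfl)
    -- At `t_K` at most `exp (η ^ 0) = e` periods remain.
    have h2 := sub_resolveTime_le_exp (T := T) hη le_rfl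
    have h3 := P.utility_mono ω hfeas (resolveTime_le η T (numResolves η T)) i
    rw [Nat.sub_self, pow_zero] at h2
    linarith
  intro y hy k
  induction k with
  | zero =>
    intro _
    have h0 : P.utility ω (x ω) 0 = 0 := funext fun i => by simp [utility]
    rw [resolveTime_zero, h0, Finset.range_zero, Finset.sum_empty, sub_zero]
    exact exists_isDivision_of_policy hn ω hy
  | succ k ih =>
    intro hk
    have hprev := ih (by omega)
    rw [Finset.sum_range_succ]
    by_cases hdev : ω ∈ P.deviationEvent η c T k
    -- Lowered by the remaining time, the target is already held by every agent.
    · refine exists_isDivision_of_le hn (fun ℓ => arrivals_nonneg _ _ _ _) fun i => ?_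
      have h1 := hloss _ (resolveTime_le _ _ _) i _ hprev
      have h2 := P.utility_mono ω hfeas (resolveTime_le_succ (T := T) hη k) i
      rw [Set.indicator_of_mem hdev, Pi.one_apply, mul_one]
      linarith
    · rw [Set.indicator_of_notMem hdev, mul_zero, add_zero]
      exact hstep T x hx ω hω k hk hdev _ hprev

end AdmissibleDist

theorem theorem2 (n : ℕ) (hn : 0 < n) (P : AdmissibleDist n) (η : ℝ)
    (hη : 1 < η) (hη' : η < 4 / 3) :
    ∃ C : ℝ, ∀ (T : ℕ) (x : P.Policy T), P.IsBIRT η x → |P.regret x| ≤ C := by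
  obtain ⟨c, hc, hpath⟩ := P.hindsightOpt_sub_le hn hη
  have hsum := summable_epochBound hη hη' (c := c ^ 2 / 8) (by positivity)
  refine ⟨Real.exp 1 + P.L * 4 * ∑' m, epochBound η (c ^ 2 / 8) m, fun T x hx => ?_⟩
  have hnonneg : 0 ≤ P.regret x := integral_nonneg fun ω =>
    sub_nonneg.2 (AdmissibleDist.egalWelfare_le_hindsightOpt hn ω (hx.mem_stdSimplex ω))
  rw [abs_of_nonneg hnonneg]
  have hint : ∀ f : P.Path T → ℝ, Integrable f (P.pathLaw T) := fun f => Integrable.of_finite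
  calc P.regret x
      ≤ ∫ ω, (Real.exp 1 + ∑ k ∈ Finset.range (numResolves η T),
          ((T : ℝ) - resolveTime η T k) * (P.deviationEvent η c T k).indicator 1 ω)
            ∂P.pathLaw T :=
        integral_mono_ae (hint _) (hint _)
          ((P.ae_p_ne_zero T).mono fun ω hω => hpath T x hx ω hω)
    _ = Real.exp 1 + ∑ k ∈ Finset.range (numResolves η T), ((T : ℝ) - resolveTime η T k)
          * (P.pathLaw T).real (P.deviationEvent η c T k) := by
        rw [integral_add (hint _) (hint _), integral_const, probReal_univ, one_smul,
          integral_finsetSum _ fun _ _ => hint _]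
        congr 1
        refine Finset.sum_congr rfl fun k _ => ?_
        rw [integral_const_mul, integral_indicator_one (Set.toFinite _).measurableSet]
    _ ≤ Real.exp 1 + ∑ k ∈ Finset.range (numResolves η T),
          P.L * 4 * epochBound η (c ^ 2 / 8) (numResolves η T - (k + 1)) := by
        refine add_le_add_right (Finset.sum_le_sum fun k hk => ?_) _
        exact P.mul_measureReal_deviationEvent_le hη hc (Finset.mem_range.1 hk)
    -- Counted backwards from the horizon, the epochs give a partial sum of a series that does not
    -- depend on `T`.
    _ = Real.exp 1 + P.L * 4 * ∑ m ∈ Finset.range (numResolves η T),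
          epochBound η (c ^ 2 / 8) m := by
        rw [← Finset.mul_sum, ← Finset.sum_range_reflect (epochBound η (c ^ 2 / 8))]
        simp only [Nat.sub_sub, add_comm 1]
    _ ≤ _ := by
        refine add_le_add_right (mul_le_mul_of_nonneg_left (hsum.sum_le_tsum _ fun m _ => ?_)
          (by positivity)) _
        unfold epochBound
        positivity
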